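/- Let $\mathfrak A$ be a unital $C^*$-algebra, let $\alpha,\theta\in\mathrm{Aut}(\mathfrak A)$ be $*$-automorphisms, and let $u\in\mathfrak A$ be a unitary with $$u\,\alpha(\theta(a))=\theta(\alpha(a))\,u\qquad(a\in\mathfrak A).$$ Let $\mathfrak A\rtimes_\alpha\mathbb Z$ be the $C^*$-crossed product, i.e. the completion, in its maximal $C^*$-norm, of the $*$-algebra of finite sums $\sum_k V^k a_k$ ($a_k\in\mathfrak A$), where $V$ is a unitary with $VaV^*=\alpha(a)$; regard $\mathfrak A$ as a subalgebra of it. Let $\Phi_{\theta,u}$ be the $*$-automorphism of $\mathfrak A\rtimes_\alpha\mathbb Z$ determined by $\Phi_{\theta,u}(a)=\theta(a)$ for $a\in\mathfrak A$ and $\Phi_{\theta,u}(V)=uV$. For a $*$-automorphism $\Psi$ of a unital $C^*$-algebra $\mathfrak B$ put $\mathfrak B^\Psi=\{b\in\mathfrak B:\Psi(b)=b\}$, and call $(\mathfrak B,\Psi)$ topologically ergodic if $\mathfrak B^\Psi=\mathbb C1$. Put $u_0=1$, $u_n=u\,\alpha(u)\cdots\alpha^{n-1}(u)$ for $n\ge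 1$, and $u_n=\alpha^{-1}(u^*)\alpha^{-2}(u^*)\cdots\alpha^{n}(u^*)$ for $n\le -1$ (so that $(uV)^n=u_nV^n$ for all $n\in\mathbb Z$). Then the following are equivalent: (i) $(\mathfrak A\rtimes_\alpha\mathbb Z)^{\Phi_{\theta,u}}=\mathfrak A^\theta$; (ii) for every integer $n\neq 0$, the only $a\in\mathfrak A$ with $\alpha^{-n}(u_n)\,\theta(a)=a$ is $a=0$. Consequently, if $(\mathfrak A,\theta)$ is topologically ergodic, then $(\mathfrak A\rtimes_\alpha\mathbb Z,\Phi_{\theta,u})$ is topologically ergodic if and only if (ii) holds. -/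

import Mathlib

universe u

noncomputable section

/-- The image of a unitary under a unital `*`-homomorphism. -/
def mapUnitary {A B : Type*} [Ring A] [StarRing A] [Algebra ℂ A] [Ring B] [StarRing B]
    [Algebra ℂ B] (φ : A →⋆ₐ[ℂ] B) : unitary A →* unitary B where
  toFun w := ⟨φ w.1, Unitary.map_mem φ w.2⟩
  map_one' := Subtype.ext (map_one φ)
  map_mul' v w := Subtype.ext (map_mul φ v.1 w.1)

/-! ### Formal sums `∑ Vⁿ aₙ` -/

/-- The finite formal sums `∑ₙ Vⁿ aₙ` with coefficients `aₙ` in `A`, where `V` is a formal unitary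
with `V a V* = α(a)`. The formal sum is stored as its coefficient function `n ↦ aₙ`. -/
def FormalSum {A : Type u} [CStarAlgebra A] (_α : A ≃⋆ₐ[ℂ] A) : Type u := ℤ →₀ A

namespace FormalSum

variable {A : Type u} [CStarAlgebra A] {α : A ≃⋆ₐ[ℂ] A}

instance instAddCommGroup : AddCommGroup (FormalSum α) := inferInstanceAs (AddCommGroup (ℤ →₀ A))

instance : Module ℂ (FormalSum α) := inferInstanceAs (Module ℂ (ℤ →₀ A))

/-- The monomial `Vⁿ a`. -/
def mono (α : A ≃⋆ₐ[ℂ] A) (n : ℤ) (a : A) : FormalSum α := Finsupp.single n a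

theorem mono_add (n : ℤ) (a b : A) : mono α n (a + b) = mono α n a + mono α n b :=
  Finsupp.single_add n a b

theorem mono_zero (n : ℤ) : mono α n 0 = 0 := Finsupp.single_zero n

theorem mono_smul (n : ℤ) (c : ℂ) (a : A) : mono α n (c • a) = c • mono α n a :=
  (Finsupp.smul_single c n a).symm

@[elab_as_elim]
theorem induction {p : FormalSum α → Prop} (f : FormalSum α) (h0 : p 0)
    (hadd : ∀ f g, p f → p g → p (f + g)) (hmono : ∀ n a, p (mono α n a)) : p f :=
  Finsupp.induction_linear (motive := p) f h0 hadd hmono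

/-- The additive map on formal sums with prescribed values on monomials. -/
def lift {M : Type*} [AddCommMonoid M] (φ : ℤ → A →+ M) : FormalSum α →+ M :=
  (Finsupp.liftAddHom φ : (ℤ →₀ A) →+ M)

theorem lift_mono {M : Type*} [AddCommMonoid M] (φ : ℤ → A →+ M) (n : ℤ) (a : A) :
    lift φ (mono α n a) = φ n a :=
  Finsupp.liftAddHom_apply_single φ n a

/-- Multiplication, determined by `(Vᵐ a) (Vⁿ b) = Vᵐ⁺ⁿ α⁻ⁿ(a) b`. -/
def mulHom (α : A ≃⋆ₐ[ℂ] A) : FormalSum α →+ FormalSum α →+ FormalSum α :=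
  lift fun m => AddMonoidHom.flip <| lift fun n =>
    AddMonoidHom.mk' (fun b => AddMonoidHom.mk' (fun a => mono α (m + n) ((α ^ (-n)) a * b))
      (fun a a' => by simp only [map_add, add_mul, mono_add]))
      (fun b b' => by
        ext a
        simp only [AddMonoidHom.mk'_apply, AddMonoidHom.add_apply, mul_add, mono_add])

/-- The involution, determined by `(Vⁿ a)* = a* V⁻ⁿ = V⁻ⁿ αⁿ(a*)`. -/
def starHom (α : A ≃⋆ₐ[ℂ] A) : FormalSum α →+ FormalSum α :=
  lift fun n => AddMonoidHom.mk' (fun a => mono α (-n) ((α ^ n) (star a)))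
    (fun a b => by simp only [star_add, map_add, mono_add])

instance : Mul (FormalSum α) := ⟨fun f g => mulHom α f g⟩

instance : One (FormalSum α) := ⟨mono α 0 1⟩

instance : Star (FormalSum α) := ⟨fun f => starHom α f⟩

theorem one_def : (1 : FormalSum α) = mono α 0 1 := rfl

theorem mono_mul_mono (m n : ℤ) (a b : A) :
    mono α m a * mono α n b = mono α (m + n) ((α ^ (-n)) a * b) := by
  change mulHom α (mono α m a) (mono α n b) = _
  rw [mulHom, lift_mono, AddMonoidHom.flip_apply, lift_mono]
  rfl

theorem star_mono (n : ℤ) (a : A) : star (mono α n a) = mono α (-n) ((α ^ n) (star a)) := by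
  change starHom α (mono α n a) = _
  rw [starHom, lift_mono]
  rfl

theorem zpow_zpow (m n : ℤ) (a : A) : (α ^ m) ((α ^ n) a) = (α ^ (m + n)) a := by
  rw [zpow_add, StarAlgEquiv.mul_apply]

protected theorem mul_add' (f g h : FormalSum α) : f * (g + h) = f * g + f * h :=
  map_add (mulHom α f) g h

protected theorem add_mul' (f g h : FormalSum α) : (f + g) * h = f * h + g * h := by
  change mulHom α (f + g) h = mulHom α f h + mulHom α g h
  rw [map_add, AddMonoidHom.add_apply]

protected theorem mul_zero' (f : FormalSum α) : f * 0 = 0 := map_zero (mulHom α f)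

protected theorem zero_mul' (f : FormalSum α) : 0 * f = 0 := by
  change mulHom α 0 f = 0
  rw [map_zero, AddMonoidHom.zero_apply]

instance : Ring (FormalSum α) where
  __ := (instAddCommGroup : AddCommGroup (FormalSum α))
  left_distrib := FormalSum.mul_add'
  right_distrib := FormalSum.add_mul'
  zero_mul := FormalSum.zero_mul'
  mul_zero := FormalSum.mul_zero'
  mul_assoc f g h := by
    induction f using FormalSum.induction with
    | h0 => simp only [FormalSum.zero_mul']
    | hadd f f' hf hf' => simp only [FormalSum.add_mul', hf, hf']
    | hmono m a =>
      induction g using FormalSum.induction with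
      | h0 => simp only [FormalSum.zero_mul', FormalSum.mul_zero']
      | hadd g g' hg hg' => simp only [FormalSum.add_mul', FormalSum.mul_add', hg, hg']
      | hmono n b =>
        induction h using FormalSum.induction with
        | h0 => simp only [FormalSum.mul_zero']
        | hadd h h' hh hh' => simp only [FormalSum.mul_add', hh, hh']
        | hmono k c =>
          simp only [mono_mul_mono, map_mul, zpow_zpow, mul_assoc, add_assoc]
          rw [show -(n + k) = -k + -n by ring]
  one_mul f := by
    induction f using FormalSum.induction with
    | h0 => simp only [FormalSum.mul_zero']
    | hadd f g hf hg => simp only [FormalSum.mul_add', hf, hg]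
    | hmono n a => rw [one_def, mono_mul_mono, map_one, one_mul, zero_add]
  mul_one f := by
    induction f using FormalSum.induction with
    | h0 => simp only [FormalSum.zero_mul']
    | hadd f g hf hg => simp only [FormalSum.add_mul', hf, hg]
    | hmono n a =>
      rw [one_def, mono_mul_mono, mul_one, add_zero, neg_zero, zpow_zero, StarAlgEquiv.one_apply]

protected theorem star_add' (f g : FormalSum α) : star (f + g) = star f + star g :=
  map_add (starHom α) f g

protected theorem star_zero' : star (0 : FormalSum α) = 0 := map_zero (starHom α)

instance : StarRing (FormalSum α) where
  star_add := FormalSum.star_add'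
  star_involutive f := by
    induction f using FormalSum.induction with
    | h0 => rw [FormalSum.star_zero', FormalSum.star_zero']
    | hadd f g hf hg => rw [FormalSum.star_add', FormalSum.star_add', hf, hg]
    | hmono n a =>
      rw [star_mono, star_mono, ← map_star, star_star, zpow_zpow, neg_add_cancel, neg_neg,
        zpow_zero, StarAlgEquiv.one_apply]
  star_mul f g := by
    induction f using FormalSum.induction with
    | h0 => simp only [FormalSum.star_zero', zero_mul, mul_zero]
    | hadd f f' hf hf' => simp only [FormalSum.star_add', add_mul, mul_add, hf, hf']
    | hmono m a =>
      induction g using FormalSum.induction with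
      | h0 => simp only [FormalSum.star_zero', zero_mul, mul_zero]
      | hadd g g' hg hg' => simp only [FormalSum.star_add', add_mul, mul_add, hg, hg']
      | hmono n b =>
        rw [mono_mul_mono, star_mono, star_mono, star_mono, mono_mul_mono, star_mul, map_mul,
          ← map_star (α ^ (-n)), zpow_zpow, zpow_zpow, neg_neg, show m + n + -n = m by ring,
          show -n + -m = -(m + n) by ring, add_comm m n]

protected theorem smul_mul' (c : ℂ) (f g : FormalSum α) : c • f * g = c • (f * g) := by
  induction f using FormalSum.induction with
  | h0 => simp only [smul_zero, zero_mul]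
  | hadd f f' hf hf' => simp only [smul_add, add_mul, hf, hf']
  | hmono m a =>
    induction g using FormalSum.induction with
    | h0 => simp only [smul_zero, mul_zero]
    | hadd g g' hg hg' => simp only [smul_add, mul_add, hg, hg']
    | hmono n b =>
      rw [← mono_smul, mono_mul_mono, mono_mul_mono, map_smul, smul_mul_assoc, mono_smul]

protected theorem mul_smul' (c : ℂ) (f g : FormalSum α) : f * c • g = c • (f * g) := by
  induction f using FormalSum.induction with
  | h0 => simp only [smul_zero, zero_mul]
  | hadd f f' hf hf' => simp only [smul_add, add_mul, hf, hf']
  | hmono m a =>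
    induction g using FormalSum.induction with
    | h0 => simp only [smul_zero, mul_zero]
    | hadd g g' hg hg' => simp only [smul_add, mul_add, hg, hg']
    | hmono n b =>
      rw [← mono_smul, mono_mul_mono, mono_mul_mono, mul_smul_comm, mono_smul]

instance : Algebra ℂ (FormalSum α) := Algebra.ofModule FormalSum.smul_mul' FormalSum.mul_smul'

instance : StarModule ℂ (FormalSum α) where
  star_smul c f := by
    induction f using FormalSum.induction with
    | h0 => simp only [smul_zero, star_zero]
    | hadd f f' hf hf' => simp only [smul_add, star_add, hf, hf']
    | hmono m a => rw [← mono_smul, star_mono, star_mono, star_smul, map_smul, mono_smul]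

/-- The coefficient algebra `A` inside the formal sums. -/
def ofCoeff (α : A ≃⋆ₐ[ℂ] A) : A →⋆ₐ[ℂ] FormalSum α where
  toFun a := mono α 0 a
  map_one' := rfl
  map_mul' a b := by
    rw [mono_mul_mono, neg_zero, zpow_zero, StarAlgEquiv.one_apply, add_zero]
  map_zero' := mono_zero 0
  map_add' := mono_add 0
  commutes' c := by
    rw [Algebra.algebraMap_eq_smul_one, Algebra.algebraMap_eq_smul_one, mono_smul, one_def]
  map_star' a := by
    rw [star_mono, neg_zero, zpow_zero, StarAlgEquiv.one_apply]

theorem ofCoeff_apply (a : A) : ofCoeff α a = mono α 0 a := rfl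

/-- The formal unitary `V`. -/
def V (α : A ≃⋆ₐ[ℂ] A) : unitary (FormalSum α) :=
  ⟨mono α 1 1, by
    rw [Unitary.mem_iff, star_mono, mono_mul_mono, mono_mul_mono]
    simp [one_def]⟩

theorem coe_V : (V α : FormalSum α) = mono α 1 1 := rfl

theorem V_mul_ofCoeff (a : A) :
    (V α : FormalSum α) * ofCoeff α a = ofCoeff α (α a) * (V α : FormalSum α) := by
  rw [coe_V, ofCoeff_apply, ofCoeff_apply, mono_mul_mono, mono_mul_mono, map_one, one_mul,
    zpow_neg_one, mul_one, StarAlgEquiv.aut_inv, StarAlgEquiv.symm_apply_apply]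
  rfl

theorem coe_V_zpow (n : ℤ) : ((V α ^ n : unitary (FormalSum α)) : FormalSum α) = mono α n 1 := by
  induction n with
  | zero => rfl
  | succ n ih =>
    rw [zpow_add_one, Submonoid.coe_mul, ih, coe_V, mono_mul_mono, map_one, mul_one]
  | pred n ih =>
    rw [zpow_sub_one, Submonoid.coe_mul, ih, ← Unitary.star_eq_inv, Unitary.coe_star, coe_V,
      star_mono, mono_mul_mono]
    simp [sub_eq_add_neg]

theorem mono_eq (n : ℤ) (a : A) :
    mono α n a = ((V α ^ n : unitary (FormalSum α)) : FormalSum α) * ofCoeff α a := by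
  rw [coe_V_zpow, ofCoeff_apply, mono_mul_mono, map_one, one_mul, add_zero]

/-! ### The maximal C*-norm -/

/-- The maximal C*-(semi)norm: the supremum of `‖π f‖` over all unital `*`-homomorphisms `π` of the
`*`-algebra of formal sums into C*-algebras. -/
def maxNorm (f : FormalSum α) : ℝ :=
  sSup {r : ℝ | ∃ (C : Type u) (_ : CStarAlgebra C) (π : FormalSum α →⋆ₐ[ℂ] C), r = ‖π f‖}

theorem exists_bound (f : FormalSum α) : ∃ M : ℝ, ∀ (C : Type u) [CStarAlgebra C]
    (π : FormalSum α →⋆ₐ[ℂ] C), ‖π f‖ ≤ M := by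
  induction f using FormalSum.induction with
  | h0 => exact ⟨0, fun C _ π => by rw [map_zero, norm_zero]⟩
  | hadd f g hf hg =>
    obtain ⟨M, hM⟩ := hf
    obtain ⟨N, hN⟩ := hg
    exact ⟨M + N, fun C _ π => by
      rw [map_add]; exact (norm_add_le _ _).trans (add_le_add (hM C π) (hN C π))⟩
  | hmono n a =>
    refine ⟨‖a‖, fun C _ π => ?_⟩
    have hV : π ((V α ^ n : unitary (FormalSum α)) : FormalSum α) ∈ unitary C :=
      Unitary.map_mem π (V α ^ n).2
    rw [mono_eq, map_mul, CStarRing.norm_mem_unitary_mul _ hV]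
    exact NonUnitalStarAlgHom.norm_apply_le (π.comp (ofCoeff α)) a

theorem bddAbove (f : FormalSum α) : BddAbove {r : ℝ | ∃ (C : Type u) (_ : CStarAlgebra C)
    (π : FormalSum α →⋆ₐ[ℂ] C), r = ‖π f‖} := by
  obtain ⟨M, hM⟩ := exists_bound f
  exact ⟨M, by rintro r ⟨C, _, π, rfl⟩; exact hM C π⟩

theorem norm_le_maxNorm {C : Type u} [CStarAlgebra C] (π : FormalSum α →⋆ₐ[ℂ] C)
    (f : FormalSum α) : ‖π f‖ ≤ maxNorm f :=
  le_csSup (bddAbove f) ⟨C, _, π, rfl⟩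

theorem maxNorm_le {f : FormalSum α} {M : ℝ} (hM : 0 ≤ M)
    (h : ∀ (C : Type u) [CStarAlgebra C] (π : FormalSum α →⋆ₐ[ℂ] C), ‖π f‖ ≤ M) :
    maxNorm f ≤ M :=
  Real.sSup_le (by rintro r ⟨C, _, π, rfl⟩; exact h C π) hM

theorem maxNorm_nonneg (f : FormalSum α) : 0 ≤ maxNorm f :=
  Real.sSup_nonneg (by rintro r ⟨C, _, π, rfl⟩; exact norm_nonneg _)

instance : SeminormedAddCommGroup (FormalSum α) :=
  AddGroupSeminorm.toSeminormedAddCommGroup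
    { toFun := maxNorm
      map_zero' := le_antisymm
        (maxNorm_le le_rfl fun C _ π => by rw [map_zero, norm_zero]) (maxNorm_nonneg 0)
      add_le' := fun f g => maxNorm_le (add_nonneg (maxNorm_nonneg f) (maxNorm_nonneg g))
        fun C _ π => by
          rw [map_add]
          exact (norm_add_le _ _).trans (add_le_add (norm_le_maxNorm π f) (norm_le_maxNorm π g))
      neg' := fun f => by simp only [maxNorm, map_neg, norm_neg] }

theorem norm_def (f : FormalSum α) : ‖f‖ = maxNorm f := rfl

instance : SeminormedRing (FormalSum α) where
  __ := (inferInstance : SeminormedAddCommGroup (FormalSum α))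
  __ := (inferInstance : Ring (FormalSum α))
  norm_mul_le f g := maxNorm_le (mul_nonneg (maxNorm_nonneg f) (maxNorm_nonneg g))
    fun C _ π => by
      rw [map_mul]
      exact (norm_mul_le _ _).trans (mul_le_mul (norm_le_maxNorm π f) (norm_le_maxNorm π g)
        (norm_nonneg _) (maxNorm_nonneg f))

instance : NormedSpace ℂ (FormalSum α) where
  norm_smul_le c f := maxNorm_le (mul_nonneg (norm_nonneg c) (maxNorm_nonneg f))
    fun C _ π => by
      rw [map_smul, norm_smul]
      exact mul_le_mul_of_nonneg_left (norm_le_maxNorm π f) (norm_nonneg c)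

instance : NormedStarGroup (FormalSum α) where
  norm_star_le f := maxNorm_le (maxNorm_nonneg f) fun C _ π => by
    rw [map_star, norm_star]
    exact norm_le_maxNorm π f

theorem norm_mul_self_le (f : FormalSum α) : ‖f‖ * ‖f‖ ≤ ‖star f * f‖ := by
  have h : ‖f‖ ≤ √‖star f * f‖ := maxNorm_le (Real.sqrt_nonneg _) fun C _ π => by
    apply Real.le_sqrt_of_sq_le
    rw [sq, ← CStarRing.norm_star_mul_self, ← map_star, ← map_mul]
    exact norm_le_maxNorm π _
  calc ‖f‖ * ‖f‖ ≤ √‖star f * f‖ * √‖star f * f‖ :=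
        mul_le_mul h h (norm_nonneg _) (Real.sqrt_nonneg _)
    _ = ‖star f * f‖ := Real.mul_self_sqrt (norm_nonneg _)

end FormalSum

/-! ### The crossed product -/

/-- The C*-crossed product `A ⋊_α ℤ`: the (Hausdorff) completion of the `*`-algebra of formal sums
in its maximal C*-norm. -/
def CrossedProduct {A : Type u} [CStarAlgebra A] (α : A ≃⋆ₐ[ℂ] A) : Type u :=
  UniformSpace.Completion (FormalSum α)

namespace CrossedProduct

variable {A : Type u} [CStarAlgebra A] {α : A ≃⋆ₐ[ℂ] A}

instance : NormedRing (CrossedProduct α) :=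
  inferInstanceAs (NormedRing (UniformSpace.Completion (FormalSum α)))

instance : CompleteSpace (CrossedProduct α) :=
  inferInstanceAs (CompleteSpace (UniformSpace.Completion (FormalSum α)))

instance : Algebra ℂ (CrossedProduct α) :=
  inferInstanceAs (Algebra ℂ (UniformSpace.Completion (FormalSum α)))

instance : NormedSpace ℂ (CrossedProduct α) :=
  inferInstanceAs (NormedSpace ℂ (UniformSpace.Completion (FormalSum α)))

instance : NormedAlgebra ℂ (CrossedProduct α) where
  norm_smul_le c x := norm_smul_le (α := ℂ) (β := CrossedProduct α) c x

/-- The canonical map of the formal sums into the crossed product. -/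
def of (α : A ≃⋆ₐ[ℂ] A) : FormalSum α →+* CrossedProduct α :=
  (UniformSpace.Completion.coeRingHom : FormalSum α →+* UniformSpace.Completion (FormalSum α))

theorem of_smul (c : ℂ) (f : FormalSum α) : of α (c • f) = c • of α f :=
  UniformSpace.Completion.coe_smul c f

theorem norm_of (f : FormalSum α) : ‖of α f‖ = ‖f‖ := UniformSpace.Completion.norm_coe f

theorem continuous_of : Continuous (of α) := UniformSpace.Completion.continuous_coe _

theorem induction_closed {p : CrossedProduct α → Prop} (x : CrossedProduct α)
    (hp : IsClosed {x | p x}) (h : ∀ f, p (of α f)) : p x :=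
  UniformSpace.Completion.induction_on (p := p) x hp h

instance : Star (CrossedProduct α) :=
  ⟨(UniformSpace.Completion.map (star : FormalSum α → FormalSum α) :
    UniformSpace.Completion (FormalSum α) → UniformSpace.Completion (FormalSum α))⟩

theorem continuous_star' : Continuous (star : CrossedProduct α → CrossedProduct α) :=
  UniformSpace.Completion.continuous_map

theorem star_of (f : FormalSum α) : star (of α f) = of α (star f) :=
  UniformSpace.Completion.map_coe (uniformContinuous_addMonoidHom_of_continuous
    (f := (starAddEquiv : FormalSum α ≃+ FormalSum α).toAddMonoidHom) continuous_star) f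

instance : CStarAlgebra (CrossedProduct α) where
  star_involutive x := by
    induction x using induction_closed with
    | hp => exact isClosed_eq (continuous_star'.comp continuous_star') continuous_id
    | h f => rw [star_of, star_of, star_star]
  star_add x y := by
    induction x using induction_closed with
    | hp =>
      exact isClosed_eq (continuous_star'.comp (continuous_id.add continuous_const))
        (continuous_star'.add continuous_const)
    | h f =>
      induction y using induction_closed with
      | hp =>
        exact isClosed_eq (continuous_star'.comp (continuous_const.add continuous_id))
          (continuous_const.add continuous_star')
      | h g => rw [star_of, star_of, ← map_add, star_of, star_add, map_add]
  star_mul x y := by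
    induction x using induction_closed with
    | hp =>
      exact isClosed_eq (continuous_star'.comp (continuous_id.mul continuous_const))
        (continuous_const.mul continuous_star')
    | h f =>
      induction y using induction_closed with
      | hp =>
        exact isClosed_eq (continuous_star'.comp (continuous_const.mul continuous_id))
          (continuous_star'.mul continuous_const)
      | h g => rw [star_of, star_of, ← map_mul, star_of, star_mul, map_mul]
  norm_mul_self_le x := by
    induction x using induction_closed with
    | hp =>
      exact isClosed_le (continuous_norm.mul continuous_norm)
        (continuous_norm.comp (continuous_star'.mul continuous_id))
    | h f =>
      rw [star_of, ← map_mul, norm_of, norm_of]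
      exact FormalSum.norm_mul_self_le f
  star_smul c x := by
    induction x using induction_closed with
    | hp =>
      exact isClosed_eq (continuous_star'.comp (continuous_const_smul c))
        (continuous_star'.const_smul (star c))
    | h f => rw [← of_smul, star_of, star_of, star_smul, of_smul]

/-- The canonical map of the formal sums into the crossed product, as a `*`-homomorphism. -/
def ofHom (α : A ≃⋆ₐ[ℂ] A) : FormalSum α →⋆ₐ[ℂ] CrossedProduct α where
  __ := of α
  commutes' c := by
    change of α (algebraMap ℂ _ c) = _
    rw [Algebra.algebraMap_eq_smul_one, Algebra.algebraMap_eq_smul_one, of_smul, map_one]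
  map_star' f := (star_of f).symm

theorem ofHom_apply (f : FormalSum α) : ofHom α f = of α f := rfl

/-- The canonical map `A → A ⋊_α ℤ`. -/
def incl (α : A ≃⋆ₐ[ℂ] A) : A →⋆ₐ[ℂ] CrossedProduct α := (ofHom α).comp (FormalSum.ofCoeff α)

/-- The canonical unitary `V` of `A ⋊_α ℤ`. -/
def V (α : A ≃⋆ₐ[ℂ] A) : unitary (CrossedProduct α) := mapUnitary (ofHom α) (FormalSum.V α)

theorem coe_V : (V α : CrossedProduct α) = ofHom α (FormalSum.V α : FormalSum α) := rfl

/-- The covariance relation `V a = α(a) V`. -/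
theorem V_mul_incl (a : A) :
    (V α : CrossedProduct α) * incl α a = incl α (α a) * (V α : CrossedProduct α) := by
  rw [coe_V, incl, StarAlgHom.comp_apply, StarAlgHom.comp_apply, ← map_mul,
    FormalSum.V_mul_ofCoeff, map_mul]

theorem ofHom_mono (n : ℤ) (a : A) : ofHom α (FormalSum.mono α n a) =
    ((V α ^ n : unitary (CrossedProduct α)) : CrossedProduct α) * incl α a := by
  rw [FormalSum.mono_eq, map_mul, V, ← map_zpow]
  rfl

/-! ### The universal property -/

theorem zpow_mul_of_covariant {C : Type u} [CStarAlgebra C] (π : A →⋆ₐ[ℂ] C) (W : unitary C)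
    (h : ∀ a, (W : C) * π a = π (α a) * W) (n : ℤ) (a : A) :
    ((W ^ n : unitary C) : C) * π a = π ((α ^ n) a) * ((W ^ n : unitary C) : C) := by
  have h' : ∀ a, ((W⁻¹ : unitary C) : C) * π a = π (α⁻¹ a) * ((W⁻¹ : unitary C) : C) := by
    intro a
    have h1 := h (α⁻¹ a)
    rw [StarAlgEquiv.aut_inv, StarAlgEquiv.apply_symm_apply] at h1
    have h2 : ((W⁻¹ : unitary C) : C) * W = 1 := by rw [← Submonoid.coe_mul]; simp
    have h3 : (W : C) * ((W⁻¹ : unitary C) : C) = 1 := by rw [← Submonoid.coe_mul]; simp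
    calc ((W⁻¹ : unitary C) : C) * π a
        = ((W⁻¹ : unitary C) : C) * (π a * W) * ((W⁻¹ : unitary C) : C) := by
          rw [mul_assoc, mul_assoc, h3, mul_one]
      _ = π (α⁻¹ a) * ((W⁻¹ : unitary C) : C) := by
          rw [← h1, ← mul_assoc, h2, one_mul, StarAlgEquiv.aut_inv]
  induction n generalizing a with
  | zero => simp
  | succ n ih =>
    rw [zpow_add_one, Submonoid.coe_mul, mul_assoc, h, ← mul_assoc, ih, mul_assoc, zpow_add_one,
      StarAlgEquiv.mul_apply]
  | pred n ih =>
    rw [zpow_sub_one, Submonoid.coe_mul, mul_assoc, h', ← mul_assoc, ih, mul_assoc, zpow_sub_one,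
      StarAlgEquiv.mul_apply]

/-- The `*`-homomorphism `∑ Vⁿ aₙ ↦ ∑ Wⁿ π(aₙ)` of a covariant pair `(π, W)`. -/
def formalLift {C : Type u} [CStarAlgebra C] (π : A →⋆ₐ[ℂ] C) (W : unitary C)
    (h : ∀ a, (W : C) * π a = π (α a) * W) : FormalSum α →⋆ₐ[ℂ] C :=
  let L : FormalSum α →+ C := FormalSum.lift fun n =>
    AddMonoidHom.mk' (fun a => ((W ^ n : unitary C) : C) * π a)
      (fun a b => by rw [map_add, mul_add])
  have hL : ∀ n a, L (FormalSum.mono α n a) = ((W ^ n : unitary C) : C) * π a :=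
    fun n a => FormalSum.lift_mono _ n a
  { toFun := L
    map_zero' := map_zero L
    map_add' := map_add L
    map_one' := by
      rw [FormalSum.one_def, hL, zpow_zero, map_one, mul_one]
      rfl
    map_mul' := fun f g => by
      induction f using FormalSum.induction with
      | h0 => simp only [zero_mul, map_zero]
      | hadd f f' hf hf' => simp only [add_mul, map_add, hf, hf']
      | hmono m a =>
        induction g using FormalSum.induction with
        | h0 => simp only [mul_zero, map_zero]
        | hadd g g' hg hg' => simp only [mul_add, map_add, hg, hg']
        | hmono n b =>
          have e : a = (α ^ n) ((α ^ (-n)) a) := by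
            rw [FormalSum.zpow_zpow, add_neg_cancel, zpow_zero, StarAlgEquiv.one_apply]
          rw [FormalSum.mono_mul_mono, hL, hL, hL, zpow_add, Submonoid.coe_mul, map_mul,
            mul_assoc, mul_assoc, ← mul_assoc _ (π _) (π b), zpow_mul_of_covariant π W h, ← e,
            mul_assoc]
    commutes' := fun c => by
      rw [Algebra.algebraMap_eq_smul_one, Algebra.algebraMap_eq_smul_one, FormalSum.one_def,
        ← FormalSum.mono_smul, hL, zpow_zero, map_smul, map_one]
      simp
    map_star' := fun f => by
      induction f using FormalSum.induction with
      | h0 => simp only [star_zero, map_zero]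
      | hadd f f' hf hf' => simp only [star_add, map_add, hf, hf']
      | hmono n a =>
        rw [FormalSum.star_mono, hL, hL, zpow_mul_of_covariant π W h, FormalSum.zpow_zpow,
          neg_add_cancel, zpow_zero, StarAlgEquiv.one_apply, star_mul, map_star, zpow_neg,
          ← Unitary.star_eq_inv, Unitary.coe_star] }

theorem formalLift_mono {C : Type u} [CStarAlgebra C] (π : A →⋆ₐ[ℂ] C) (W : unitary C)
    (h : ∀ a, (W : C) * π a = π (α a) * W) (n : ℤ) (a : A) :
    formalLift π W h (FormalSum.mono α n a) = ((W ^ n : unitary C) : C) * π a :=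
  FormalSum.lift_mono _ n a

theorem continuous_formal {C : Type u} [CStarAlgebra C] (π : FormalSum α →⋆ₐ[ℂ] C) :
    Continuous π :=
  AddMonoidHomClass.continuous_of_bound π 1 fun f => by
    rw [one_mul]; exact FormalSum.norm_le_maxNorm π f

/-- The `*`-homomorphism on the crossed product extending one on the formal sums. -/
def extend {C : Type u} [CStarAlgebra C] (π : FormalSum α →⋆ₐ[ℂ] C) : CrossedProduct α →⋆ₐ[ℂ] C :=
  let E : CrossedProduct α →+* C :=
    (UniformSpace.Completion.extensionHom (π : FormalSum α →+* C) (continuous_formal π) :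
      UniformSpace.Completion (FormalSum α) →+* C)
  have hE : ∀ f, E (of α f) = π f :=
    UniformSpace.Completion.extensionHom_coe (π : FormalSum α →+* C) (continuous_formal π)
  have hc : Continuous E := UniformSpace.Completion.continuous_extension
  { E with
    commutes' := fun c => by
      change E (of α (algebraMap ℂ _ c)) = _
      rw [hE, AlgHomClass.commutes]
    map_star' := fun x => by
      change E (star x) = star (E x)
      induction x using induction_closed with
      | hp => exact isClosed_eq (hc.comp continuous_star') (continuous_star.comp hc)
      | h f => rw [star_of, hE, hE, map_star] }

theorem extend_ofHom {C : Type u} [CStarAlgebra C] (π : FormalSum α →⋆ₐ[ℂ] C) (f : FormalSum α) :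
    extend π (ofHom α f) = π f :=
  UniformSpace.Completion.extensionHom_coe (π : FormalSum α →+* C) (continuous_formal π) f

/-- The universal property of the crossed product: a covariant pair `(π, W)` induces a
`*`-homomorphism with `a ↦ π(a)` and `V ↦ W`. -/
def lift {C : Type u} [CStarAlgebra C] (π : A →⋆ₐ[ℂ] C) (W : unitary C)
    (h : ∀ a, (W : C) * π a = π (α a) * W) : CrossedProduct α →⋆ₐ[ℂ] C :=
  extend (formalLift π W h)

theorem lift_incl {C : Type u} [CStarAlgebra C] (π : A →⋆ₐ[ℂ] C) (W : unitary C)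
    (h : ∀ a, (W : C) * π a = π (α a) * W) (a : A) : lift π W h (incl α a) = π a := by
  rw [lift, incl, StarAlgHom.comp_apply, extend_ofHom, FormalSum.ofCoeff_apply, formalLift_mono,
    zpow_zero]
  simp

theorem lift_V {C : Type u} [CStarAlgebra C] (π : A →⋆ₐ[ℂ] C) (W : unitary C)
    (h : ∀ a, (W : C) * π a = π (α a) * W) : lift π W h (V α : CrossedProduct α) = W := by
  rw [lift, coe_V, extend_ofHom, FormalSum.coe_V, formalLift_mono, zpow_one, map_one, mul_one]

theorem hom_ext {C : Type u} [CStarAlgebra C] {φ ψ : CrossedProduct α →⋆ₐ[ℂ] C}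
    (hA : ∀ a, φ (incl α a) = ψ (incl α a))
    (hV : φ (V α : CrossedProduct α) = ψ (V α : CrossedProduct α)) : φ = ψ := by
  have hVn : ∀ n : ℤ, φ ((V α ^ n : unitary (CrossedProduct α)) : CrossedProduct α) =
      ψ ((V α ^ n : unitary (CrossedProduct α)) : CrossedProduct α) := by
    intro n
    have : mapUnitary φ (V α) = mapUnitary ψ (V α) := Subtype.ext hV
    have h2 : mapUnitary φ (V α ^ n) = mapUnitary ψ (V α ^ n) := by
      rw [map_zpow, map_zpow, this]
    exact congrArg Subtype.val h2
  ext x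
  induction x using induction_closed with
  | hp =>
    exact isClosed_eq
      (AddMonoidHomClass.continuous_of_bound φ 1 fun y => by
        rw [one_mul]; exact NonUnitalStarAlgHom.norm_apply_le φ y)
      (AddMonoidHomClass.continuous_of_bound ψ 1 fun y => by
        rw [one_mul]; exact NonUnitalStarAlgHom.norm_apply_le ψ y)
  | h f =>
    rw [← ofHom_apply]
    induction f using FormalSum.induction with
    | h0 => simp only [map_zero]
    | hadd f g hf hg => simp only [map_add, hf, hg]
    | hmono n a => rw [ofHom_mono, map_mul, map_mul, hVn, hA]

end CrossedProduct

/-! ### The skew-product automorphism -/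

/-- `u ∈ U(A)` intertwines: `u (α ∘ θ)(a) = (θ ∘ α)(a) u` for all `a ∈ A`. -/
def Intertwines {A : Type u} [CStarAlgebra A] (α θ : A ≃⋆ₐ[ℂ] A) (u : unitary A) : Prop :=
  ∀ a : A, (u : A) * α (θ a) = θ (α a) * (u : A)

namespace Intertwines

variable {A : Type u} [CStarAlgebra A] {α θ : A ≃⋆ₐ[ℂ] A} {u : unitary A}

theorem symm (h : Intertwines α θ u) :
    Intertwines α θ.symm (mapUnitary (θ.symm : A →⋆ₐ[ℂ] A) (star u)) := by
  intro a
  have h1 := h (θ.symm a)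
  rw [StarAlgEquiv.apply_symm_apply] at h1
  apply θ.injective
  change θ (θ.symm (star (u : A)) * α (θ.symm a)) = θ (θ.symm (α a) * θ.symm (star (u : A)))
  rw [map_mul, map_mul, StarAlgEquiv.apply_symm_apply, StarAlgEquiv.apply_symm_apply]
  calc star (u : A) * θ (α (θ.symm a))
      = star (u : A) * (θ (α (θ.symm a)) * u) * star (u : A) := by
        rw [mul_assoc, mul_assoc, Unitary.mul_star_self_of_mem u.2, mul_one]
    _ = α a * star (u : A) := by
        rw [← h1, ← mul_assoc, Unitary.star_mul_self_of_mem u.2, one_mul]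

end Intertwines

namespace CrossedProduct

variable {A : Type u} [CStarAlgebra A] {α θ : A ≃⋆ₐ[ℂ] A} {u : unitary A}

/-- The unital `*`-endomorphism of `A ⋊_α ℤ` with `a ↦ θ(a)` and `V ↦ u V`. -/
def skewHom (h : Intertwines α θ u) : CrossedProduct α →⋆ₐ[ℂ] CrossedProduct α :=
  lift ((incl α).comp (θ : A →⋆ₐ[ℂ] A)) (mapUnitary (incl α) u * V α) (by
    intro a
    change incl α u * (V α : CrossedProduct α) * incl α (θ a) =
      incl α (θ (α a)) * (incl α u * (V α : CrossedProduct α))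
    rw [mul_assoc, V_mul_incl, ← mul_assoc, ← mul_assoc, ← map_mul, ← map_mul, h a])

theorem skewHom_incl (h : Intertwines α θ u) (a : A) :
    skewHom h (incl α a) = incl α (θ a) := lift_incl _ _ _ a

theorem skewHom_V (h : Intertwines α θ u) :
    skewHom h (V α : CrossedProduct α) = incl α u * (V α : CrossedProduct α) := lift_V _ _ _

theorem skewHom_symm_comp (h : Intertwines α θ u) :
    (skewHom h.symm).comp (skewHom h) = StarAlgHom.id ℂ _ := by
  apply hom_ext
  · intro a
    rw [StarAlgHom.comp_apply, skewHom_incl, skewHom_incl, StarAlgEquiv.symm_apply_apply]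
    rfl
  · rw [StarAlgHom.comp_apply, skewHom_V, map_mul, skewHom_incl, skewHom_V, ← mul_assoc, ← map_mul]
    change incl α (θ.symm (u : A) * θ.symm (star (u : A))) * _ = _
    rw [← map_mul, Unitary.mul_star_self_of_mem u.2, map_one, map_one, one_mul]
    rfl

theorem skewHom_comp_symm (h : Intertwines α θ u) :
    (skewHom h).comp (skewHom h.symm) = StarAlgHom.id ℂ _ := by
  apply hom_ext
  · intro a
    rw [StarAlgHom.comp_apply, skewHom_incl, skewHom_incl, StarAlgEquiv.apply_symm_apply]
    rfl
  · rw [StarAlgHom.comp_apply, skewHom_V, map_mul, skewHom_incl, skewHom_V, ← mul_assoc, ← map_mul]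
    change incl α (θ (θ.symm (star (u : A))) * (u : A)) * _ = _
    rw [StarAlgEquiv.apply_symm_apply, Unitary.star_mul_self_of_mem u.2, map_one, one_mul]
    rfl

/-- The skew-product automorphism `Φ_{θ,u}` of `A ⋊_α ℤ`, with `a ↦ θ(a)` and `V ↦ u V`. -/
def skewProduct (h : Intertwines α θ u) : CrossedProduct α ≃⋆ₐ[ℂ] CrossedProduct α :=
  StarAlgEquiv.ofStarAlgHom (skewHom h) (skewHom h.symm) (skewHom_symm_comp h)
    (skewHom_comp_symm h)

theorem skewProduct_incl (h : Intertwines α θ u) (a : A) :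
    skewProduct h (incl α a) = incl α (θ a) := skewHom_incl h a

theorem skewProduct_V (h : Intertwines α θ u) :
    skewProduct h (V α : CrossedProduct α) = incl α u * (V α : CrossedProduct α) := skewHom_V h

end CrossedProduct

/-! ### Fixed points, ergodicity, and the cohomological equations -/

/-- The fixed-point algebra `A^θ = {a | θ(a) = a}`. -/
def fixedPointAlgebra {A : Type u} [CStarAlgebra A] (θ : A ≃⋆ₐ[ℂ] A) : StarSubalgebra ℂ A where
  carrier := {a | θ a = a}
  mul_mem' {a b} (ha : θ a = a) (hb : θ b = b) := by
    change θ (a * b) = a * b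
    rw [map_mul, ha, hb]
  add_mem' {a b} (ha : θ a = a) (hb : θ b = b) := by
    change θ (a + b) = a + b
    rw [map_add, ha, hb]
  algebraMap_mem' c := by
    change θ (algebraMap ℂ A c) = algebraMap ℂ A c
    rw [Algebra.algebraMap_eq_smul_one, map_smul, map_one]
  star_mem' {a} (ha : θ a = a) := by
    change θ (star a) = star a
    rw [map_star, ha]

/-- `(A, θ)` is topologically ergodic: `A^θ = ℂ 1`. -/
def TopologicallyErgodic {A : Type u} [CStarAlgebra A] (θ : A ≃⋆ₐ[ℂ] A) : Prop :=
  (fixedPointAlgebra θ : Set A) = {a | ∃ c : ℂ, a = c • (1 : A)}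

/-- The elements `uₙ`, `n ∈ ℤ`: `u₀ = 1`, `uₙ = u α(u) ⋯ αⁿ⁻¹(u)` for `n ≥ 1`, and
`uₙ = α⁻¹(u*) α⁻²(u*) ⋯ αⁿ(u*)` for `n ≤ -1`. -/
def cocycle {A : Type u} [CStarAlgebra A] (α : A ≃⋆ₐ[ℂ] A) (u : A) : ℤ → A
  | Int.ofNat n => ((List.range n).map fun k : ℕ => (α ^ (k : ℤ)) u).prod
  | Int.negSucc n => ((List.range (n + 1)).map fun k : ℕ => (α ^ (-((k : ℤ) + 1))) (star u)).prod

/-- For every `n ≠ 0`, the equation `α⁻ⁿ(uₙ) θ(a) = a` has only the trivial solution `a = 0`. -/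
def NoNontrivialSolutions {A : Type u} [CStarAlgebra A] (α θ : A ≃⋆ₐ[ℂ] A) (u : unitary A) :
    Prop :=
  ∀ n : ℤ, n ≠ 0 → ∀ a : A, (α ^ (-n)) (cocycle α u n) * θ a = a → a = 0

end

/-! The proof is Fourier analysis for the gauge action of the circle on `A ⋊_α ℤ`, which fixes `A`
and sends `V` to `e^{2πit} V`. Integrating against characters gives contractive projections
`component n`. The range of `component n` lies in `Vⁿ A` (`exists_component_eq`), and an element
whose components vanish for all `n ≠ 0` equals its zeroth component (`eq_component_zero`).

Since `u` lies in `A`, the skew product commutes with the gauge action, hence with every `component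
n`. So the components of a fixed point are fixed. On monomials, `Φ(Vⁿ a) = (uV)ⁿ θ(a) = Vⁿ α⁻ⁿ(uₙ)
θ(a)` (`skewProduct_monomial`), so `Vⁿ a` is fixed exactly when `a` solves the `n`-th equation. If
all solutions with `n ≠ 0` vanish, a fixed point is its own zeroth component and lies in `A`;
conversely a nonzero solution produces a fixed point outside `A`.

Both directions, and the closedness of `Vⁿ A`, need `A` to embed isometrically (`incl_injective`).
This follows from the regular representation on `ℓ²(ℤ, H)`, built on a Hilbert space representation
of `A` obtained by GNS from a suitable positive functional. -/

noncomputable section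

/-! ### States and faithful representations -/

section States

open scoped ComplexOrder

variable {A : Type u} [CStarAlgebra A]

/-- A contractive unital functional takes real values on self-adjoint elements. -/
theorem im_eq_zero_of_isSelfAdjoint (f : A →L[ℂ] ℂ) (hf : ‖f‖ ≤ 1) (h1 : f 1 = 1) {a : A}
    (ha : IsSelfAdjoint a) : (f a).im = 0 := by
  have : Nontrivial A := ⟨1, 0, fun h => by simp [h] at h1⟩
  -- Compare `|f(a + it)|` with `‖a + it‖`: self-adjointness of `a` gives `(a + it)*(a + it) = a² +
  -- t²`, with no cross term, whereas `|f(a + it)|²` contains `2t · Im f(a)`.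
  have key : ∀ t : ℝ, (f a).re ^ 2 + ((f a).im + t) ^ 2 ≤ ‖a‖ ^ 2 + t ^ 2 := by
    intro t
    set x : A := a + algebraMap ℂ A (t * Complex.I) with hx
    have hfx : f x = f a + t * Complex.I := by
      rw [hx, map_add, Algebra.algebraMap_eq_smul_one, map_smul, h1, smul_eq_mul, mul_one]
    have hn : ‖f x‖ ≤ ‖x‖ := (f.le_of_opNorm_le hf x).trans_eq (one_mul _)
    have hxx : star x * x = a * a + algebraMap ℂ A ((t : ℂ) ^ 2) := by
      rw [hx, star_add, ha.star_eq, ← algebraMap_star_comm, add_mul, mul_add, mul_add,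
        ← Algebra.commutes _ a, ← map_mul]
      have e1 : star ((t : ℂ) * Complex.I) = -((t : ℂ) * Complex.I) := by simp
      have e2 : -((t : ℂ) * Complex.I) * ((t : ℂ) * Complex.I) = (t : ℂ) ^ 2 := by
        linear_combination (-(t : ℂ) ^ 2) * Complex.I_sq
      rw [e1, e2, map_neg]
      noncomm_ring
    have h2 : ‖x‖ ^ 2 ≤ ‖a‖ ^ 2 + t ^ 2 := by
      rw [sq, ← CStarRing.norm_star_mul_self, hxx]
      refine (norm_add_le _ _).trans (add_le_add ?_ ?_)
      · exact (norm_mul_le _ _).trans_eq (sq _).symm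
      · rw [norm_algebraMap', norm_pow, Complex.norm_real, Real.norm_eq_abs, sq_abs]
    have h3 : ‖f x‖ ^ 2 = (f a).re ^ 2 + ((f a).im + t) ^ 2 := by
      rw [hfx, Complex.sq_norm, Complex.normSq_apply]
      simp
      ring
    rw [← h3]
    exact (pow_le_pow_left₀ (norm_nonneg _) hn 2).trans h2
  by_contra him
  -- This `t` makes the cross term `2t · Im f(a)` equal to `‖a‖² + 1`, more than the bound allows.
  have h4 := key ((‖a‖ ^ 2 + 1) / (2 * (f a).im))
  have h5 : 2 * (f a).im * ((‖a‖ ^ 2 + 1) / (2 * (f a).im)) = ‖a‖ ^ 2 + 1 := by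
    field_simp
  nlinarith [sq_nonneg (f a).re, sq_nonneg (f a).im]

variable [PartialOrder A] [StarOrderedRing A]

/-- A contractive unital functional on a C*-algebra is positive. -/
theorem nonneg_of_norm_le_one (f : A →L[ℂ] ℂ) (hf : ‖f‖ ≤ 1) (h1 : f 1 = 1) {a : A}
    (ha : 0 ≤ a) : 0 ≤ f a := by
  refine Complex.nonneg_iff.mpr ⟨?_, (im_eq_zero_of_isSelfAdjoint f hf h1 (.of_nonneg ha)).symm⟩
  -- From `0 ≤ ‖a‖ - a ≤ ‖a‖`. Applying `f` puts `f a` in the disc of radius `‖a‖` about `‖a‖`,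
  -- which lies in the right half plane.
  have hle : ‖algebraMap ℝ A ‖a‖ - a‖ ≤ ‖a‖ := by
    rw [CStarAlgebra.norm_le_iff_le_algebraMap _ (norm_nonneg a)
      (sub_nonneg.mpr (IsSelfAdjoint.of_nonneg ha).le_algebraMap_norm_self)]
    exact sub_le_self _ ha
  have h2 : f (algebraMap ℝ A ‖a‖ - a) = (‖a‖ : ℂ) - f a := by
    rw [map_sub, IsScalarTower.algebraMap_apply ℝ ℂ A, Algebra.algebraMap_eq_smul_one (A := A),
      map_smul, h1, smul_eq_mul, mul_one]
    rfl
  have h3 : ‖(‖a‖ : ℂ) - f a‖ ≤ ‖a‖ := by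
    rw [← h2]
    exact ((f.le_of_opNorm_le hf _).trans_eq (one_mul _)).trans hle
  have h4 := (Complex.re_le_norm _).trans h3
  simp at h4
  exact h4

/-- By Gelfand duality, some character of the commutative C*-algebra generated by `b` does not kill
`b`. A norm-preserving Hahn–Banach extension of it is contractive and unital, hence positive. -/
theorem exists_positive_apply_ne_zero {b : A} (hb : IsSelfAdjoint b) (hb0 : b ≠ 0) :
    ∃ f : A →ₚ[ℂ] ℂ, f b ≠ 0 := by
  have : Nontrivial A := ⟨b, 0, hb0⟩
  have : IsStarNormal b := hb.isStarNormal
  let S := StarAlgebra.elemental ℂ b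
  let b' : S := ⟨b, StarAlgebra.elemental.self_mem ℂ b⟩
  have hb' : gelfandStarTransform S b' ≠ 0 := by
    rw [Ne, EmbeddingLike.map_eq_zero_iff]
    exact fun h => hb0 (congrArg Subtype.val h)
  obtain ⟨χ, hχ⟩ : ∃ χ, gelfandStarTransform S b' χ ≠ 0 := by
    by_contra! h
    exact hb' (ContinuousMap.ext h)
  obtain ⟨g, hg, hgn⟩ := exists_extension_norm_eq S.toSubmodule
    (WeakDual.toStrongDual (χ : WeakDual ℂ S))
  have hg1 : g 1 = 1 := (hg (1 : S)).trans (map_one χ)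
  have hgn1 : ‖g‖ ≤ 1 := by
    rw [hgn]
    exact (WeakDual.CharacterSpace.norm_le_norm_one χ).trans_eq norm_one
  refine ⟨PositiveLinearMap.mk₀ g.toLinearMap fun x hx => nonneg_of_norm_le_one g hgn1 hg1 hx, ?_⟩
  change g b ≠ 0
  rw [show g b = χ b' from hg b']
  exact hχ

end States

/-- Every nonzero element of a C*-algebra acts nontrivially in some Hilbert space
representation. -/
theorem exists_representation_ne_zero {A : Type u} [CStarAlgebra A] {a : A} (ha : a ≠ 0) :
    ∃ (H : Type u) (_ : NormedAddCommGroup H) (_ : InnerProductSpace ℂ H) (_ : CompleteSpace H)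
      (π : A →⋆ₐ[ℂ] (H →L[ℂ] H)), π a ≠ 0 := by
  let _ := CStarAlgebra.spectralOrder A
  have _ := CStarAlgebra.spectralOrderedRing A
  -- With `f(a*a) ≠ 0`, the class of `1` in the GNS space is a vector not killed by `a`, since its
  -- image has squared norm `f(a*a)`.
  obtain ⟨f, hf⟩ := exists_positive_apply_ne_zero (IsSelfAdjoint.star_mul_self a)
    (fun h => ha ((CStarRing.star_mul_self_eq_zero_iff a).mp h))
  refine ⟨f.GNS, inferInstance, inferInstance, inferInstance, f.gnsStarAlgHom, fun h => hf ?_⟩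
  have h1 : f.gnsNonUnitalStarAlgHom a (f.toPreGNS 1 : f.PreGNS) = 0 := by
    have := congrArg (fun T => T ((f.toPreGNS 1 : f.PreGNS) : f.GNS)) h
    simpa using this
  rw [PositiveLinearMap.gnsNonUnitalStarAlgHom_apply_coe] at h1
  have h2 : ‖f.leftMulMapPreGNS a (f.toPreGNS 1)‖ = 0 := by
    rw [← UniformSpace.Completion.norm_coe, h1, norm_zero]
  have h3 := f.preGNS_norm_sq (f.leftMulMapPreGNS a (f.toPreGNS 1))
  rw [h2] at h3
  simpa using h3.symm

/-! ### The regular representation -/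

section Regular

open scoped InnerProductSpace

variable {H : Type u} [NormedAddCommGroup H] [InnerProductSpace ℂ H]

/-- Reindexing of `ℓ²` along a permutation of the index set. -/
def lpReindex {ι : Type*} (σ : Equiv.Perm ι) :
    lp (fun _ : ι => H) 2 ≃ₗᵢ[ℂ] lp (fun _ : ι => H) 2 :=
  have hp : 0 < (2 : ENNReal).toReal := by simp
  have mem : ∀ (τ : Equiv.Perm ι) (x : lp (fun _ : ι => H) 2),
      Memℓp (E := fun _ : ι => H) (fun i => x (τ i)) 2 := fun τ x =>
    memℓp_gen (((lp.memℓp x).summable hp).comp_injective τ.injective)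
  { toFun := fun x => ⟨fun i => x (σ i), mem σ x⟩
    invFun := fun x => ⟨fun i => x (σ.symm i), mem σ.symm x⟩
    map_add' := fun x y => rfl
    map_smul' := fun c x => rfl
    left_inv := fun x => by ext i; exact congrArg x (σ.apply_symm_apply i)
    right_inv := fun x => by ext i; exact congrArg x (σ.symm_apply_apply i)
    norm_map' := fun x => by
      rw [lp.norm_eq_tsum_rpow hp, lp.norm_eq_tsum_rpow hp]
      exact congrArg (· ^ (1 / (2 : ENNReal).toReal))
        (σ.tsum_eq fun i => ‖x i‖ ^ (2 : ENNReal).toReal) }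

variable [CompleteSpace H] {A : Type u} [CStarAlgebra A]

/-- The diagonal representation on `ℓ²` of a family of representations. -/
def diagonalRep {ι : Type*} (π : ι → A →⋆ₐ[ℂ] (H →L[ℂ] H)) :
    A →⋆ₐ[ℂ] (lp (fun _ : ι => H) 2 →L[ℂ] lp (fun _ : ι => H) 2) where
  toFun a := lp.mapCLM 2 (fun i => π i a) (norm_nonneg a)
    fun i => NonUnitalStarAlgHom.norm_apply_le (π i) a
  map_one' := by ext x i; simp
  map_mul' a b := by ext x i; simp
  map_zero' := by ext x i; simp
  map_add' a b := by ext x i; simp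
  commutes' c := by ext x i; simp [Algebra.algebraMap_eq_smul_one]
  map_star' a := by
    refine (ContinuousLinearMap.eq_adjoint_iff _ _).mpr fun x y => ?_
    rw [lp.inner_eq_tsum, lp.inner_eq_tsum]
    refine tsum_congr fun i => ?_
    rw [lp.mapCLM_apply_coe, lp.mapCLM_apply_coe, map_star, ContinuousLinearMap.star_eq_adjoint,
      ContinuousLinearMap.adjoint_inner_left]

theorem diagonalRep_apply {ι : Type*} (π : ι → A →⋆ₐ[ℂ] (H →L[ℂ] H)) (a : A)
    (x : lp (fun _ : ι => H) 2) (i : ι) : diagonalRep π a x i = π i a (x i) := rfl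

end Regular

/-! ### Faithfulness of `A → A ⋊_α ℤ` -/

namespace CrossedProduct

variable {A : Type u} [CStarAlgebra A] {α : A ≃⋆ₐ[ℂ] A}

/-- If `π(a) ≠ 0`, then `(ρ(b)x)(k) = π(α⁻ᵏ(b)) x(k)` and the shift `(Wx)(k) = x(k - 1)` form a
covariant pair on `ℓ²(ℤ, H)`. Its lift restricts to `ρ` on `A`, and the coordinate `k = 0` of `ρ`
recovers `π`. -/
theorem incl_injective : Function.Injective (incl α) := by
  rw [injective_iff_map_eq_zero]
  intro a ha
  by_contra h0
  obtain ⟨H, _, _, _, π, hπ⟩ := exists_representation_ne_zero h0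
  let ρ := diagonalRep fun k : ℤ => π.comp ((α ^ (-k) : A ≃⋆ₐ[ℂ] A) : A →⋆ₐ[ℂ] A)
  let W := Unitary.linearIsometryEquiv.symm (lpReindex (H := H) (Equiv.subRight (1 : ℤ)))
  have hW : ∀ b, (W : lp (fun _ : ℤ => H) 2 →L[ℂ] lp (fun _ : ℤ => H) 2) * ρ b =
      ρ (α b) * W := by
    intro b
    ext x k
    change π ((α ^ (-(k - 1))) b) (x (k - 1)) = π ((α ^ (-k)) (α b)) (x (k - 1))
    rw [show -(k - 1) = -k + 1 by ring, zpow_add_one, StarAlgEquiv.mul_apply]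
  have h1 : ρ a = 0 := by rw [← lift_incl ρ W hW a, ha, map_zero]
  apply hπ
  ext v
  have h2 := congrArg (fun T => T (lp.single 2 (0 : ℤ) v) 0) h1
  simpa [ρ, diagonalRep_apply] using h2

theorem isometry_incl : Isometry (incl α) :=
  NonUnitalStarAlgHom.isometry (incl α) incl_injective

end CrossedProduct

/-! ### The gauge action and Fourier coefficients -/

namespace CrossedProduct

open MeasureTheory AddCircle

variable {A : Type u} [CStarAlgebra A] {α : A ≃⋆ₐ[ℂ] A}

theorem continuous_starAlgHom {B C : Type*} [CStarAlgebra B] [CStarAlgebra C]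
    (φ : B →⋆ₐ[ℂ] C) : Continuous φ :=
  AddMonoidHomClass.continuous_of_bound φ 1 fun y => by
    rw [one_mul]; exact NonUnitalStarAlgHom.norm_apply_le φ y

/-- The scalar `e^{2πit}` as a unitary of `ℂ`. -/
def phase (t : UnitAddCircle) : unitary ℂ :=
  ⟨fourier 1 t, by
    have h : star (fourier 1 t : ℂ) * fourier 1 t = 1 := by
      rw [Complex.star_def, ← fourier_neg, ← fourier_add, neg_add_cancel, fourier_zero]
    exact Unitary.mem_iff.mpr ⟨h, by rw [mul_comm, h]⟩⟩

theorem coe_phase_zpow (t : UnitAddCircle) (n : ℤ) :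
    ((phase t ^ n : unitary ℂ) : ℂ) = fourier n t := by
  rw [Unitary.coe_zpow]
  change (fourier 1 t : ℂ) ^ n = fourier n t
  rw [fourier_apply, fourier_apply, one_zsmul, toCircle_zsmul, Circle.coe_zpow]

/-- The unitary `e^{2πit} V`. -/
def gaugeV (α : A ≃⋆ₐ[ℂ] A) (t : UnitAddCircle) : unitary (CrossedProduct α) :=
  mapUnitary (StarAlgHom.ofId ℂ (CrossedProduct α)) (phase t) * V α

theorem coe_gaugeV (t : UnitAddCircle) :
    (gaugeV α t : CrossedProduct α) = (fourier 1 t : ℂ) • (V α : CrossedProduct α) :=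
  (Algebra.smul_def _ _).symm

theorem coe_gaugeV_zpow (t : UnitAddCircle) (n : ℤ) :
    ((gaugeV α t ^ n : unitary (CrossedProduct α)) : CrossedProduct α) =
      (fourier n t : ℂ) • ((V α ^ n : unitary (CrossedProduct α)) : CrossedProduct α) := by
  have hc : Commute (mapUnitary (StarAlgHom.ofId ℂ (CrossedProduct α)) (phase t)) (V α) :=
    Subtype.ext (Algebra.commutes _ _)
  rw [gaugeV, hc.mul_zpow, ← map_zpow, Submonoid.coe_mul]
  change algebraMap ℂ (CrossedProduct α) ((phase t ^ n : unitary ℂ) : ℂ) * _ = _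
  rw [coe_phase_zpow, Algebra.smul_def]

/-- The gauge action of the circle: `a ↦ a` and `V ↦ e^{2πit} V`. -/
def gauge (α : A ≃⋆ₐ[ℂ] A) (t : UnitAddCircle) : CrossedProduct α →⋆ₐ[ℂ] CrossedProduct α :=
  lift (incl α) (gaugeV α t) fun a => by
    rw [coe_gaugeV, smul_mul_assoc, V_mul_incl, mul_smul_comm]

theorem gauge_incl (t : UnitAddCircle) (a : A) : gauge α t (incl α a) = incl α a :=
  lift_incl _ _ _ a

theorem gauge_V (t : UnitAddCircle) :
    gauge α t (V α : CrossedProduct α) = (fourier 1 t : ℂ) • (V α : CrossedProduct α) :=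
  (lift_V _ _ _).trans (coe_gaugeV t)

theorem gauge_monomial (t : UnitAddCircle) (n : ℤ) (a : A) :
    gauge α t (((V α ^ n : unitary (CrossedProduct α)) : CrossedProduct α) * incl α a) =
      (fourier n t : ℂ) •
        (((V α ^ n : unitary (CrossedProduct α)) : CrossedProduct α) * incl α a) := by
  rw [← ofHom_mono, gauge, lift, extend_ofHom, formalLift_mono, coe_gaugeV_zpow, smul_mul_assoc,
    ofHom_mono]

theorem gauge_zero (x : CrossedProduct α) : gauge α 0 x = x := by
  have h : gauge α 0 = StarAlgHom.id ℂ (CrossedProduct α) :=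
    hom_ext (fun a => gauge_incl 0 a) (by rw [gauge_V, fourier_eval_zero, one_smul]; rfl)
  rw [h]
  rfl

theorem norm_gauge_le (t : UnitAddCircle) (x : CrossedProduct α) : ‖gauge α t x‖ ≤ ‖x‖ :=
  NonUnitalStarAlgHom.norm_apply_le (gauge α t) x

/-- Each `gauge α t` is a contraction, so approximating `x` by a formal sum approximates the orbit
uniformly in `t`. On monomials the orbit is a character times a constant. -/
theorem continuous_gauge (x : CrossedProduct α) : Continuous fun t => gauge α t x := by
  refine continuous_of_uniform_approx_of_continuous fun U hU => ?_
  obtain ⟨ε, hε, hU⟩ := Metric.mem_uniformity_dist.mp hU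
  have hd : DenseRange (of α) := UniformSpace.Completion.denseRange_coe
  obtain ⟨f, hf⟩ := Metric.denseRange_iff.mp hd x ε hε
  refine ⟨fun t => gauge α t (of α f), ?_, fun t => hU ?_⟩
  · rw [← ofHom_apply]
    -- Closeness to `x` does not pass to summands, so it must not enter the induction.
    clear hf
    induction f using FormalSum.induction with
    | h0 => simp only [map_zero, continuous_const]
    | hadd f g hf hg => simp only [map_add]; exact hf.add hg
    | hmono n a =>
      simp only [ofHom_mono, gauge_monomial]
      exact (fourier n).continuous.smul continuous_const
  · rw [dist_eq_norm, ← map_sub]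
    rw [dist_eq_norm] at hf
    exact (norm_gauge_le t _).trans_lt hf

/-- The `n`-th spectral component `∫ e^{-2πint} λ_t(x) dt` of `x` for the gauge action `λ`. -/
def component (n : ℤ) (x : CrossedProduct α) : CrossedProduct α :=
  fourierCoeff (fun t => gauge α t x) n

theorem integrable_fourier_smul_gauge (n : ℤ) (x : CrossedProduct α) :
    Integrable (fun t => (fourier n t : ℂ) • gauge α t x) (haarAddCircle (T := 1)) :=
  ((fourier n).continuous.smul (continuous_gauge x)).integrable_of_hasCompactSupport
    (HasCompactSupport.of_compactSpace _)

theorem component_add (n : ℤ) (x y : CrossedProduct α) :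
    component n (x + y) = component n x + component n y := by
  simp only [component, fourierCoeff, map_add, smul_add]
  exact integral_add (integrable_fourier_smul_gauge _ x) (integrable_fourier_smul_gauge _ y)

theorem norm_component_le (n : ℤ) (x : CrossedProduct α) : ‖component n x‖ ≤ ‖x‖ := by
  refine (norm_integral_le_of_norm_le_const (C := ‖x‖) (.of_forall fun t => ?_)).trans_eq
    (by simp)
  rw [norm_smul]
  have h1 : ‖(fourier (-n) t : ℂ)‖ = 1 := by rw [fourier_apply]; exact Circle.norm_coe _
  rw [h1, one_mul]
  exact norm_gauge_le t x

theorem continuous_component (n : ℤ) : Continuous (component (α := α) n) :=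
  AddMonoidHomClass.continuous_of_bound (AddMonoidHom.mk' (component (α := α) n)
    (component_add n)) 1 fun x => by rw [one_mul]; exact norm_component_le n x

/-- The orbit of `Vᵐ a` is `e^{2πimt} Vᵐ a`, so this is orthogonality of the characters of the
circle. -/
theorem component_monomial (n m : ℤ) (a : A) :
    component n (((V α ^ m : unitary (CrossedProduct α)) : CrossedProduct α) * incl α a) =
      (Pi.single m 1 : ℤ → ℂ) n •
        (((V α ^ m : unitary (CrossedProduct α)) : CrossedProduct α) * incl α a) := by
  simp only [component, fourierCoeff, gauge_monomial, smul_smul]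
  rw [integral_smul_const]
  congr 1
  exact congrFun (fourierCoeff_fourier (T := 1) m) n

/-- A bounded linear map can be moved under the integral; this is applied to the skew product. -/
theorem map_component (φ : CrossedProduct α →L[ℂ] CrossedProduct α)
    (hφ : ∀ t x, φ (gauge α t x) = gauge α t (φ x)) (n : ℤ) (x : CrossedProduct α) :
    φ (component n x) = component n (φ x) := by
  rw [component, fourierCoeff, ← φ.integral_comp_comm (integrable_fourier_smul_gauge (-n) x)]
  simp only [map_smul, hφ]
  rfl

/-- The claim is clear for finite sums and passes to limits because `Vⁿ A` is closed, being the
range of the isometry `a ↦ Vⁿ a`. -/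
theorem exists_component_eq (n : ℤ) (x : CrossedProduct α) :
    ∃ a, component n x = ((V α ^ n : unitary (CrossedProduct α)) : CrossedProduct α) *
      incl α a := by
  let j : A → CrossedProduct α := fun a =>
    ((V α ^ n : unitary (CrossedProduct α)) : CrossedProduct α) * incl α a
  have hj : Isometry j := Isometry.of_dist_eq fun a b => by
    rw [dist_eq_norm, ← mul_sub, CStarRing.norm_mem_unitary_mul _ (V α ^ n).2, ← dist_eq_norm,
      isometry_incl.dist_eq]
  suffices h : component n x ∈ Set.range j by
    obtain ⟨a, ha⟩ := h
    exact ⟨a, ha.symm⟩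
  induction x using induction_closed with
  | hp => exact hj.isClosedEmbedding.isClosed_range.preimage (continuous_component n)
  | h f =>
    rw [← ofHom_apply]
    induction f using FormalSum.induction with
    | h0 =>
      refine ⟨0, ?_⟩
      have h0 : component (α := α) n 0 = 0 := by simp [component, fourierCoeff]
      simp only [j, map_zero, mul_zero, h0]
    | hadd f g hf hg =>
      obtain ⟨a, ha⟩ := hf
      obtain ⟨b, hb⟩ := hg
      refine ⟨a + b, ?_⟩
      rw [map_add, component_add, ← ha, ← hb]
      simp only [j, map_add, mul_add]
    | hmono m a =>
      rw [ofHom_mono, component_monomial]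
      rcases eq_or_ne n m with rfl | hne
      · exact ⟨a, by simp [j]⟩
      · exact ⟨0, by simp [j, hne]⟩

/-- An element is determined by its spectral components. -/
theorem eq_component_zero (x : CrossedProduct α) (hx : ∀ n ≠ 0, component n x = 0) :
    x = component 0 x := by
  -- Testing against a functional `l` reduces the claim to the scalar function `t ↦ l(gauge α t x)`,
  -- whose Fourier coefficients are `l(component n x)`.
  refine (SeparatingDual.eq_iff_forall_dual_eq (R := ℂ)).mpr fun l => ?_
  let g : C(UnitAddCircle, ℂ) := ⟨fun t => l (gauge α t x), l.continuous.comp (continuous_gauge x)⟩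
  have hg : ∀ n, fourierCoeff g n = l (component n x) := fun n => by
    rw [component, fourierCoeff, fourierCoeff,
      ← l.integral_comp_comm (integrable_fourier_smul_gauge (-n) x)]
    simp only [map_smul]
    rfl
  have hz : ∀ n ≠ 0, fourierCoeff g n = 0 := fun n hn => by rw [hg, hx n hn, map_zero]
  have hs : Summable (fourierCoeff g) :=
    summable_of_ne_finset_zero (s := {0}) fun n hn => hz n (by simpa using hn)
  -- The Fourier series has a single possibly nonzero term, hence converges pointwise to the
  -- function. It is evaluated at `t = 0`, where the gauge action is trivial.
  have h1 := (has_pointwise_sum_fourier_series_of_summable hs 0).unique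
    (hasSum_single 0 fun n hn => by rw [hz n hn, zero_smul])
  rw [fourier_zero, smul_eq_mul, mul_one, hg] at h1
  rw [← h1]
  exact congrArg l (gauge_zero x).symm

end CrossedProduct

/-! ### The skew product on monomials -/

section SkewMonomial

variable {A : Type u} [CStarAlgebra A] {α θ : A ≃⋆ₐ[ℂ] A} {u : unitary A}

theorem cocycle_natCast_succ (α : A ≃⋆ₐ[ℂ] A) (u : A) (n : ℕ) :
    cocycle α u ((n + 1 : ℕ) : ℤ) = cocycle α u (n : ℤ) * (α ^ (n : ℤ)) u := by
  change ((List.range (n + 1)).map fun k : ℕ => (α ^ (k : ℤ)) u).prod = _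
  rw [List.range_succ, List.map_append, List.prod_append]
  simp [cocycle]

theorem cocycle_neg_natCast_succ (α : A ≃⋆ₐ[ℂ] A) (u : A) (n : ℕ) :
    cocycle α u (-((n + 1 : ℕ) : ℤ)) =
      cocycle α u (-(n : ℤ)) * (α ^ (-((n : ℤ) + 1))) (star u) := by
  -- The `Int.negSucc` formula also covers `n = 0`, where the product is empty.
  have h : ∀ n : ℕ, cocycle α u (-(n : ℤ)) =
      ((List.range n).map fun k : ℕ => (α ^ (-((k : ℤ) + 1))) (star u)).prod := by
    rintro (_ | n)
    · rfl
    · rfl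
  rw [h, h, List.range_succ, List.map_append, List.prod_append]
  simp

namespace CrossedProduct

theorem V_zpow_mul_incl (n : ℤ) (a : A) :
    ((V α ^ n : unitary (CrossedProduct α)) : CrossedProduct α) * incl α a =
      incl α ((α ^ n) a) * ((V α ^ n : unitary (CrossedProduct α)) : CrossedProduct α) :=
  zpow_mul_of_covariant (incl α) (V α) V_mul_incl n a

/-- `(u V)ⁿ = uₙ Vⁿ`. -/
theorem mul_V_zpow (u : unitary A) (n : ℤ) :
    (((mapUnitary (incl α) u * V α) ^ n : unitary (CrossedProduct α)) : CrossedProduct α) =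
      incl α (cocycle α u n) * ((V α ^ n : unitary (CrossedProduct α)) : CrossedProduct α) := by
  have hu : ((mapUnitary (incl α) u : unitary (CrossedProduct α)) : CrossedProduct α) =
      incl α u := rfl
  have hpos : ∀ n : ℕ, (((mapUnitary (incl α) u * V α) ^ (n : ℤ) :
      unitary (CrossedProduct α)) : CrossedProduct α) =
      incl α (cocycle α u n) * ((V α ^ (n : ℤ) : unitary (CrossedProduct α)) :
        CrossedProduct α) := by
    intro n
    induction n with
    | zero => simp [cocycle]
    | succ n ih =>
      rw [cocycle_natCast_succ, Nat.cast_succ, zpow_add_one, zpow_add_one, Submonoid.coe_mul, ih,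
        Submonoid.coe_mul, Submonoid.coe_mul, hu, map_mul, mul_assoc, ← mul_assoc _ (incl α u),
        V_zpow_mul_incl]
      simp only [mul_assoc]
  have hneg : ∀ n : ℕ, (((mapUnitary (incl α) u * V α) ^ (-(n : ℤ)) :
      unitary (CrossedProduct α)) : CrossedProduct α) =
      incl α (cocycle α u (-(n : ℤ))) * ((V α ^ (-(n : ℤ)) : unitary (CrossedProduct α)) :
        CrossedProduct α) := by
    intro n
    induction n with
    | zero => simp [cocycle]
    | succ n ih =>
      -- Here `(uV)⁻¹ = V⁻¹ u*`; moving `u*` to the left past `V⁻ⁿ⁻¹` turns it into the new factor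
      -- `α⁻ⁿ⁻¹(u*)`.
      have h1 : -((n + 1 : ℕ) : ℤ) = -(n : ℤ) - 1 := by push_cast; ring
      have h2 : V α ^ (-(n : ℤ)) * (V α)⁻¹ = V α ^ (-((n : ℤ) + 1)) := by
        rw [← zpow_sub_one]; congr 1; ring
      rw [cocycle_neg_natCast_succ, h1, zpow_sub_one, Submonoid.coe_mul, ih, mul_inv_rev,
        mul_assoc, ← Submonoid.coe_mul, ← mul_assoc, h2, Submonoid.coe_mul,
        ← Unitary.star_eq_inv (mapUnitary (incl α) u), Unitary.coe_star, hu, ← map_star,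
        V_zpow_mul_incl, map_mul, mul_assoc]
      congr 4
  obtain ⟨m, rfl | rfl⟩ := n.eq_nat_or_neg
  · exact hpos m
  · exact hneg m

/-- Write the image as `(uV)ⁿ θ(a) = uₙ Vⁿ θ(a)` and move `uₙ` to the right of `Vⁿ`. This is where
the equations in (ii) come from. -/
theorem skewProduct_monomial (h : Intertwines α θ u) (n : ℤ) (a : A) :
    skewProduct h (((V α ^ n : unitary (CrossedProduct α)) : CrossedProduct α) * incl α a) =
      ((V α ^ n : unitary (CrossedProduct α)) : CrossedProduct α) *
        incl α ((α ^ (-n)) (cocycle α u n) * θ a) := by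
  have h1 : skewProduct h (((V α ^ n : unitary (CrossedProduct α)) : CrossedProduct α) *
      incl α a) = (((mapUnitary (incl α) u * V α) ^ n : unitary (CrossedProduct α)) :
        CrossedProduct α) * incl α (θ a) := by
    change skewHom h _ = _
    rw [← ofHom_mono, skewHom, lift, extend_ofHom, formalLift_mono]
    rfl
  rw [h1, mul_V_zpow, map_mul, ← mul_assoc, V_zpow_mul_incl, FormalSum.zpow_zpow, add_neg_cancel,
    zpow_zero, StarAlgEquiv.one_apply]

/-- It suffices to check generators: both composites send `a` to `θ(a)` and `V` to `e^{2πit} uV`,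
because the gauge action fixes `u`. -/
theorem skewProduct_gauge (h : Intertwines α θ u) (t : UnitAddCircle) (x : CrossedProduct α) :
    skewProduct h (gauge α t x) = gauge α t (skewProduct h x) := by
  have e : (skewHom h).comp (gauge α t) = (gauge α t).comp (skewHom h) := by
    apply hom_ext
    · intro a
      simp only [StarAlgHom.comp_apply, gauge_incl, skewHom_incl]
    · simp only [StarAlgHom.comp_apply, gauge_V, map_smul, skewHom_V, map_mul, gauge_incl,
        mul_smul_comm]
  exact DFunLike.congr_fun e x

theorem skewProduct_component (h : Intertwines α θ u) (n : ℤ) (x : CrossedProduct α) :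
    skewProduct h (component n x) = component n (skewProduct h x) :=
  map_component ⟨(skewHom h).toAlgHom.toLinearMap, continuous_starAlgHom (skewHom h)⟩
    (skewProduct_gauge h) n x

/-! ### Fixed points and ergodicity of the skew product -/

theorem incl_mem_fixedPointAlgebra_iff (h : Intertwines α θ u) (a : A) :
    incl α a ∈ fixedPointAlgebra (skewProduct h) ↔ a ∈ fixedPointAlgebra θ := by
  change skewProduct h (incl α a) = incl α a ↔ θ a = a
  rw [skewProduct_incl, incl_injective.eq_iff]

theorem fixedPointAlgebra_eq_iff (h : Intertwines α θ u) :
    fixedPointAlgebra (skewProduct h) = (fixedPointAlgebra θ).map (incl α) ↔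
      NoNontrivialSolutions α θ u := by
  constructor
  · intro heq n hn a ha
    have hmem : ((V α ^ n : unitary (CrossedProduct α)) : CrossedProduct α) * incl α a ∈
        fixedPointAlgebra (skewProduct h) := by
      change skewProduct h _ = _
      rw [skewProduct_monomial, ha]
    rw [heq] at hmem
    obtain ⟨b, -, hb⟩ := hmem
    -- The fixed monomial `Vⁿ a` equals some `b` in `A`, a monomial of degree `0`. Taking `n`-th
    -- components with `n ≠ 0` then gives `Vⁿ a = 0`.
    have hb0 : incl α b =
        ((V α ^ (0 : ℤ) : unitary (CrossedProduct α)) : CrossedProduct α) * incl α b := by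
      simp
    have h1 : component n (((V α ^ n : unitary (CrossedProduct α)) : CrossedProduct α) *
        incl α a) = component n (incl α b) := congrArg (component n) hb.symm
    rw [hb0, component_monomial, component_monomial, Pi.single_eq_same, one_smul,
      Pi.single_eq_of_ne hn, zero_smul, ← norm_eq_zero,
      CStarRing.norm_mem_unitary_mul _ (V α ^ n).2, norm_eq_zero] at h1
    exact incl_injective (h1.trans (map_zero _).symm)
  · intro hns
    ext x
    constructor
    · intro hx
      have hc : ∀ n, skewProduct h (component n x) = component n x := fun n => by
        rw [skewProduct_component, show skewProduct h x = x from hx]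
      have hx0 : x = component 0 x := by
        refine eq_component_zero x fun n hn => ?_
        obtain ⟨a, ha⟩ := exists_component_eq n x
        have h1 := hc n
        rw [ha, skewProduct_monomial] at h1
        -- Cancelling the unitary `Vⁿ` and embedding `A` faithfully turns invariance of the `n`-th
        -- component into the `n`-th equation for `a`.
        have h2 := incl_injective ((Unitary.toUnits (V α ^ n)).mul_right_inj.mp h1)
        rw [ha, hns n hn a h2, map_zero, mul_zero]
      obtain ⟨a, ha⟩ := exists_component_eq 0 x
      rw [← hx0, zpow_zero, OneMemClass.coe_one, one_mul] at ha
      rw [ha] at hx ⊢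
      exact ⟨a, (incl_mem_fixedPointAlgebra_iff h a).mp hx, rfl⟩
    · rintro ⟨a, ha, rfl⟩
      exact (incl_mem_fixedPointAlgebra_iff h a).mpr ha

/-- When `A^θ` consists of the scalars, so does its image under the unital map `incl α`, and the two
conditions become the same equality. -/
theorem topologicallyErgodic_iff (h : Intertwines α θ u) (hθ : TopologicallyErgodic θ) :
    TopologicallyErgodic (skewProduct h) ↔
      fixedPointAlgebra (skewProduct h) = (fixedPointAlgebra θ).map (incl α) := by
  have e : (((fixedPointAlgebra θ).map (incl α) : StarSubalgebra ℂ (CrossedProduct α)) :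
      Set (CrossedProduct α)) = {x | ∃ c : ℂ, x = c • (1 : CrossedProduct α)} := by
    rw [StarSubalgebra.coe_map, hθ]
    ext x
    constructor
    · rintro ⟨_, ⟨c, rfl⟩, rfl⟩
      exact ⟨c, by rw [map_smul, map_one]⟩
    · rintro ⟨c, rfl⟩
      exact ⟨c • 1, ⟨c, rfl⟩, by rw [map_smul, map_one]⟩
  rw [TopologicallyErgodic, ← e, SetLike.coe_set_eq]

end CrossedProduct

end SkewMonomial

end

theorem mainTheorem3 {A : Type u} [CStarAlgebra A] (α θ : A ≃⋆ₐ[ℂ] A) (u : unitary A)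
    (h : Intertwines α θ u) :
    (fixedPointAlgebra (CrossedProduct.skewProduct h) =
        (fixedPointAlgebra θ).map (CrossedProduct.incl α) ↔
      NoNontrivialSolutions α θ u) ∧
    (TopologicallyErgodic θ →
      (TopologicallyErgodic (CrossedProduct.skewProduct h) ↔ NoNontrivialSolutions α θ u)) :=
  ⟨CrossedProduct.fixedPointAlgebra_eq_iff h, fun hθ =>
    (CrossedProduct.topologicallyErgodic_iff h hθ).trans (CrossedProduct.fixedPointAlgebra_eq_iff h)⟩
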